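/- Let $G$ be a connected non-abelian (real, finite-dimensional) Lie group with Lie algebra $\mathfrak g$, endowed with a left-invariant Riemannian metric $h$, and let $\langle\cdot,\cdot\rangle$ be the scalar product induced by $h$ on $\mathfrak g$. Suppose that $(G,h)$ is cyclic, that is, $$\langle [X,Y],Z\rangle+\langle [Y,Z],X\rangle+\langle [Z,X],Y\rangle=0\qquad\text{for all } X,Y,Z\in\mathfrak g.$$ Then the scalar curvature of $(G,h)$ is negative. In particular, neither the sectional curvature nor the Ricci curvature of $(G,h)$ is positive: it is not the case that every tangent plane has positive sectional curvature, and it is not the case that $\mathrm{ric}(X,X)>0$ for every $X\in\mathfrak g\setminus\{0\}$. Here the curvatures are those of the Levi-Civita connection, computed on left-invariant vector fields: with $X\star Y$ defined by $2\langle X\star Y,Z\rangle=\langle[X,Y],Z\rangle+\langle[Z,X],Y\rangle+\langle[Z,Y],X\rangle$ and $\mathrm L_XY=X\star Y$, the curvature is $\mathrm K(X,Y)=\mathrm L_{[X,Y]}-[\mathrm L_X,\mathrm L_Y]$, the Ricci curvature is $\mathrm{ric}(X,Y)=\mathrm{tr}(Z\mapsto \mathrm K(X,Z)Y)$, the scalar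 curvature is the trace of $\mathrm{ric}$ with respect to $\langle\cdot,\cdot\rangle$, and the sectional curvature of the plane spanned by $X,Y$ is $\langle \mathrm K(X,Y)X,Y\rangle/(\langle X,X\rangle\langle Y,Y\rangle-\langle X,Y\rangle^2)$. -/

import Mathlib

open Bundle
open scoped Manifold ContDiff

noncomputable section

/-! ### Curvature of a finite-dimensional real Lie algebra with a scalar product -/

/-- A scalar product on a real vector space: a symmetric positive definite bilinear form. -/
structure ScalarProduct (V : Type*) [AddCommGroup V] [Module ℝ V] where
  form : LinearMap.BilinForm ℝ V
  symm : ∀ u v : V, form u v = form v u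
  pos : ∀ u : V, u ≠ 0 → 0 < form u u

namespace ScalarProduct

theorem nondegenerate {V : Type*} [AddCommGroup V] [Module ℝ V] (s : ScalarProduct V) :
    s.form.Nondegenerate := by
  refine ⟨fun u hu => ?_, fun u hu => ?_⟩ <;>
  · by_contra h
    exact absurd (hu u) (s.pos u h).ne'

/-- The isomorphism `u ↦ ⟨u, ·⟩` from `V` to its dual. -/
def toDual {V : Type*} [AddCommGroup V] [Module ℝ V] [FiniteDimensional ℝ V]
    (s : ScalarProduct V) : V ≃ₗ[ℝ] Module.Dual ℝ V :=
  LinearMap.BilinForm.toDual s.form s.nondegenerate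

@[simp]
theorem form_toDual_symm {V : Type*} [AddCommGroup V] [Module ℝ V] [FiniteDimensional ℝ V]
    (s : ScalarProduct V) (f : Module.Dual ℝ V) (v : V) :
    s.form (s.toDual.symm f) v = f v :=
  LinearMap.BilinForm.apply_toDual_symm_apply (hB := s.nondegenerate) f v

variable {L : Type*} [LieRing L] [LieAlgebra ℝ L]

/-- Half of the right-hand side of Koszul's formula, as a linear form in `Z`:
`Z ↦ (⟨[X, Y], Z⟩ + ⟨[Z, X], Y⟩ + ⟨[Z, Y], X⟩) / 2`. -/
def koszulForm (s : ScalarProduct L) (X Y : L) : Module.Dual ℝ L where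
  toFun Z := (s.form ⁅X, Y⁆ Z + s.form ⁅Z, X⁆ Y + s.form ⁅Z, Y⁆ X) / 2
  map_add' Z W := by simp only [map_add, add_lie, LinearMap.add_apply]; ring
  map_smul' c Z := by
    simp only [map_smul, smul_lie, LinearMap.smul_apply, smul_eq_mul, RingHom.id_apply]; ring

variable [FiniteDimensional ℝ L]

/-- The Levi-Civita product `X ⋆ Y` on `L`, i.e. the bilinear product determined by
`2 ⟨X ⋆ Y, Z⟩ = ⟨[X, Y], Z⟩ + ⟨[Z, X], Y⟩ + ⟨[Z, Y], X⟩` for all `Z`.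
`s.leviCivita X` is the left multiplication `Y ↦ X ⋆ Y`. -/
def leviCivita (s : ScalarProduct L) : L →ₗ[ℝ] Module.End ℝ L :=
  LinearMap.mk₂ ℝ (fun X Y => s.toDual.symm (s.koszulForm X Y))
    (fun X X' Y => by
      rw [← map_add]; congr 1; ext Z
      simp only [koszulForm, LinearMap.coe_mk, AddHom.coe_mk, LinearMap.add_apply, map_add,
        add_lie, lie_add]; ring)
    (fun c X Y => by
      rw [← map_smul]; congr 1; ext Z
      simp only [koszulForm, LinearMap.coe_mk, AddHom.coe_mk, LinearMap.smul_apply, map_smul,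
        smul_lie, lie_smul, smul_eq_mul]; ring)
    (fun X Y Y' => by
      rw [← map_add]; congr 1; ext Z
      simp only [koszulForm, LinearMap.coe_mk, AddHom.coe_mk, LinearMap.add_apply, map_add,
        lie_add]; ring)
    (fun c X Y => by
      rw [← map_smul]; congr 1; ext Z
      simp only [koszulForm, LinearMap.coe_mk, AddHom.coe_mk, LinearMap.smul_apply, map_smul,
        lie_smul, smul_eq_mul]; ring)

theorem koszul_formula (s : ScalarProduct L) (X Y Z : L) :
    2 * s.form (s.leviCivita X Y) Z
      = s.form ⁅X, Y⁆ Z + s.form ⁅Z, X⁆ Y + s.form ⁅Z, Y⁆ X := by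
  simp only [leviCivita, LinearMap.mk₂_apply, form_toDual_symm, koszulForm, LinearMap.coe_mk,
    AddHom.coe_mk]
  ring

/-- The curvature `K(X, Y) = L_{[X, Y]} - [L_X, L_Y]`, where `L_X Y = X ⋆ Y`. -/
def curvature (s : ScalarProduct L) (X Y : L) : Module.End ℝ L :=
  s.leviCivita ⁅X, Y⁆ - (s.leviCivita X * s.leviCivita Y - s.leviCivita Y * s.leviCivita X)

/-- The endomorphism `Z ↦ K(X, Z) Y`. -/
def curvatureEnd (s : ScalarProduct L) (X Y : L) : Module.End ℝ L where
  toFun Z := s.curvature X Z Y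
  map_add' Z W := by simp only [curvature, lie_add, map_add, LinearMap.sub_apply,
    Module.End.mul_apply, LinearMap.add_apply]; abel
  map_smul' c Z := by simp only [curvature, lie_smul, map_smul, LinearMap.sub_apply,
    Module.End.mul_apply, LinearMap.smul_apply, RingHom.id_apply, smul_sub]

/-- The Ricci curvature `ric(X, Y) = tr (Z ↦ K(X, Z) Y)`, as a bilinear form. -/
def ricci (s : ScalarProduct L) : LinearMap.BilinForm ℝ L :=
  LinearMap.mk₂ ℝ (fun X Y => LinearMap.trace ℝ L (s.curvatureEnd X Y))
    (fun X X' Y => by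
      rw [← map_add]; congr 1; ext Z
      simp only [curvatureEnd, curvature, LinearMap.coe_mk, AddHom.coe_mk, LinearMap.add_apply,
        LinearMap.sub_apply, Module.End.mul_apply, map_add, add_lie]; abel)
    (fun c X Y => by
      rw [← map_smul]; congr 1; ext Z
      simp only [curvatureEnd, curvature, LinearMap.coe_mk, AddHom.coe_mk, LinearMap.smul_apply,
        LinearMap.sub_apply, Module.End.mul_apply, map_smul, smul_lie, smul_sub])
    (fun X Y Y' => by
      rw [← map_add]; congr 1; ext Z
      simp only [curvatureEnd, LinearMap.coe_mk, AddHom.coe_mk, LinearMap.add_apply, map_add])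
    (fun c X Y => by
      rw [← map_smul]; congr 1; ext Z
      simp only [curvatureEnd, LinearMap.coe_mk, AddHom.coe_mk, LinearMap.smul_apply, map_smul])

/-- The scalar curvature: the trace of the Ricci operator `Ric`, given by
`⟨Ric X, Y⟩ = ric(X, Y)`. -/
def scalarCurvature (s : ScalarProduct L) : ℝ :=
  LinearMap.trace ℝ L (s.toDual.symm.toLinearMap ∘ₗ s.ricci)

/-- The sectional curvature of the plane spanned by two linearly independent vectors `X`, `Y`. -/
def sectionalCurvature (s : ScalarProduct L) (X Y : L) : ℝ :=
  s.form (s.curvature X Y X) Y / (s.form X X * s.form Y Y - s.form X Y ^ 2)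

end ScalarProduct

/-! ### Left-invariant Riemannian metrics on Lie groups -/

section LieGroup

variable {n : ℕ} {G : Type*} [TopologicalSpace G] [ChartedSpace (EuclideanSpace ℝ (Fin n)) G]
  [Group G]

instance LieGroup.minSmoothness_three [LieGroup (𝓡 n) ∞ G] :
    LieGroup (𝓡 n) (minSmoothness ℝ 3) G :=
  LieGroup.of_le (n := ∞) (by
    rw [minSmoothness_of_isRCLikeNormedField]; exact ENat.LEInfty.out)

instance GroupLieAlgebra.finiteDimensional : FiniteDimensional ℝ (GroupLieAlgebra (𝓡 n) G) :=
  inferInstanceAs (FiniteDimensional ℝ (EuclideanSpace ℝ (Fin n)))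

variable [LieGroup (𝓡 n) ∞ G]

namespace Bundle.ContMDiffRiemannianMetric

/-- The left translations of `G` are isometries of `h`. -/
def IsLeftInvariant
    (h : ContMDiffRiemannianMetric (𝓡 n) ∞ (EuclideanSpace ℝ (Fin n))
      (fun x : G => TangentSpace (𝓡 n) x)) : Prop :=
  ∀ (g x : G) (u v : TangentSpace (𝓡 n) x),
    h.inner (g * x) (mfderiv (𝓡 n) (𝓡 n) (g * ·) x u) (mfderiv (𝓡 n) (𝓡 n) (g * ·) x v)
      = h.inner x u v

/-- The scalar product induced by `h` on the Lie algebra of `G` (the tangent space at the identity,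
identified with the space of left-invariant vector fields). -/
def lieScalarProduct
    (h : ContMDiffRiemannianMetric (𝓡 n) ∞ (EuclideanSpace ℝ (Fin n))
      (fun x : G => TangentSpace (𝓡 n) x)) : ScalarProduct (GroupLieAlgebra (𝓡 n) G) where
  form := LinearMap.mk₂ ℝ (fun u v => h.inner 1 u v)
    (fun u u' v => by simp) (fun c u v => by simp) (fun u v v' => by simp) (fun c u v => by simp)
  symm u v := h.symm 1 u v
  pos u hu := h.pos 1 u hu

/-- `(G, h)` is a cyclic Riemannian Lie group: `h` is left-invariant and
`⟨[X, Y], Z⟩ + ⟨[Y, Z], X⟩ + ⟨[Z, X], Y⟩ = 0` on the Lie algebra of `G`. -/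
def IsCyclic
    (h : ContMDiffRiemannianMetric (𝓡 n) ∞ (EuclideanSpace ℝ (Fin n))
      (fun x : G => TangentSpace (𝓡 n) x)) : Prop :=
  h.IsLeftInvariant ∧ ∀ X Y Z : GroupLieAlgebra (𝓡 n) G,
    h.lieScalarProduct.form ⁅X, Y⁆ Z + h.lieScalarProduct.form ⁅Y, Z⁆ X
      + h.lieScalarProduct.form ⁅Z, X⁆ Y = 0

/-- On left-invariant vector fields, a left-invariant metric is constant. -/
theorem IsLeftInvariant.inner_mulInvariant
    {h : ContMDiffRiemannianMetric (𝓡 n) ∞ (EuclideanSpace ℝ (Fin n))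
      (fun x : G => TangentSpace (𝓡 n) x)} (hinv : h.IsLeftInvariant)
    (X Y : GroupLieAlgebra (𝓡 n) G) (g : G) :
    h.inner g (mulInvariantVectorField X g) (mulInvariantVectorField Y g)
      = h.lieScalarProduct.form X Y := by
  have := hinv g 1 X Y
  have key : ∀ g' : G, g' = g → ∀ u v : EuclideanSpace ℝ (Fin n),
      h.inner g' u v = h.inner g u v := by rintro _ rfl u v; rfl
  exact (key _ (mul_one g) _ _).symm.trans this

/-- Every tangent vector is a value of a left-invariant vector field. -/
theorem IsLeftInvariant.exists_mulInvariant_eq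
    {h : ContMDiffRiemannianMetric (𝓡 n) ∞ (EuclideanSpace ℝ (Fin n))
      (fun x : G => TangentSpace (𝓡 n) x)} (hinv : h.IsLeftInvariant)
    (g : G) (w : TangentSpace (𝓡 n) g) :
    ∃ Z : GroupLieAlgebra (𝓡 n) G, mulInvariantVectorField Z g = w := by
  let A : EuclideanSpace ℝ (Fin n) →ₗ[ℝ] EuclideanSpace ℝ (Fin n) :=
    (mfderiv (𝓡 n) (𝓡 n) (g * ·) (1 : G)).toLinearMap
  have hA : Function.Injective A := by
    refine (injective_iff_map_eq_zero A).2 fun X hX => ?_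
    by_contra hne
    have h1 := h.pos 1 X hne
    have h2 : h.inner g (mulInvariantVectorField (I := 𝓡 n) X g)
        (mulInvariantVectorField (I := 𝓡 n) X g) = h.inner 1 X X := hinv.inner_mulInvariant X X g
    have h3 : mulInvariantVectorField (I := 𝓡 n) X g = 0 := hX
    rw [h3, map_zero] at h2
    exact h1.ne h2
  exact (LinearMap.injective_iff_surjective.1 hA) w

/-- The algebraic Levi-Civita product is the Levi-Civita connection of `h` on left-invariant vector
fields: any torsion-free metric connection satisfies `∇_X Y = X ⋆ Y`. -/
theorem IsLeftInvariant.covariantDerivative_mulInvariant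
    {h : ContMDiffRiemannianMetric (𝓡 n) ∞ (EuclideanSpace ℝ (Fin n))
      (fun x : G => TangentSpace (𝓡 n) x)} (hinv : h.IsLeftInvariant)
    (cov : CovariantDerivative (𝓡 n) (EuclideanSpace ℝ (Fin n))
      (TangentSpace (𝓡 n) : G → Type _))
    (htor : cov.torsion = 0)
    (hmet : letI : RiemannianBundle (fun x : G => TangentSpace (𝓡 n) x) := ⟨h.toRiemannianMetric⟩
      cov.IsMetricCompatible)
    (X Y : GroupLieAlgebra (𝓡 n) G) (g : G) :
    cov (mulInvariantVectorField Y) g (mulInvariantVectorField X g)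
      = mulInvariantVectorField (h.lieScalarProduct.leviCivita X Y) g := by
  have D : ∀ (X : GroupLieAlgebra (𝓡 n) G), MDifferentiableAt (𝓡 n) (𝓡 n).tangent
      (fun x : G => (mulInvariantVectorField X x : TangentBundle (𝓡 n) G)) g :=
    fun X => mdifferentiableAt_mulInvariantVectorField X
  have T : ∀ X Y : GroupLieAlgebra (𝓡 n) G,
      cov (mulInvariantVectorField Y) g (mulInvariantVectorField X g)
        = cov (mulInvariantVectorField X) g (mulInvariantVectorField Y g)
          + mulInvariantVectorField ⁅X, Y⁆ g := by
    intro X Y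
    have := (cov.torsion_eq_zero_iff.1 htor) (D X) (D Y)
    rw [← mulInvariantVector_mlieBracket] at this
    rw [GroupLieAlgebra.bracket_def, ← this]; abel
  have M : ∀ X Y Z : GroupLieAlgebra (𝓡 n) G,
      h.inner g (cov (mulInvariantVectorField Y) g (mulInvariantVectorField X g))
        (mulInvariantVectorField Z g)
      + h.inner g (mulInvariantVectorField Y g)
        (cov (mulInvariantVectorField Z) g (mulInvariantVectorField X g)) = 0 := by
    intro X Y Z
    let _ : RiemannianBundle (fun x : G => TangentSpace (𝓡 n) x) := ⟨h.toRiemannianMetric⟩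
    have := CovariantDerivative.IsMetricCompatible.mvfderiv_inner_eq hmet
      (mulInvariantVectorField X) (D Y) (D Z)
    have e : (fun x : G => Inner.inner ℝ (mulInvariantVectorField (I := 𝓡 n) Y x)
        (mulInvariantVectorField (I := 𝓡 n) Z x)) = fun _ => h.lieScalarProduct.form Y Z :=
      funext fun x => hinv.inner_mulInvariant Y Z x
    rw [e] at this
    refine Eq.trans this.symm ?_
    simp [mvfderiv]
  have key : ∀ Z : GroupLieAlgebra (𝓡 n) G,
      h.inner g (cov (mulInvariantVectorField Y) g (mulInvariantVectorField X g))
        (mulInvariantVectorField Z g)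
      = h.inner g (mulInvariantVectorField (h.lieScalarProduct.leviCivita X Y) g)
        (mulInvariantVectorField Z g) := by
    intro Z
    have K := h.lieScalarProduct.koszul_formula X Y Z
    rw [hinv.inner_mulInvariant]
    let P := fun A B C : GroupLieAlgebra (𝓡 n) G =>
      h.inner g (cov (mulInvariantVectorField B) g (mulInvariantVectorField A g))
        (mulInvariantVectorField C g)
    have M' : ∀ A B C, P A B C + P A C B = 0 := fun A B C => by
      have := M A B C
      rwa [h.symm g (mulInvariantVectorField B g)] at this
    have T' : ∀ A B C, P A B C = P B A C + h.lieScalarProduct.form ⁅A, B⁆ C := fun A B C => by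
      change h.inner g _ _ = _
      rw [T A B, map_add, ← hinv.inner_mulInvariant ⁅A, B⁆ C g]
      rfl
    have e : h.lieScalarProduct.form ⁅Z, X⁆ Y = - h.lieScalarProduct.form ⁅X, Z⁆ Y := by
      rw [← lie_skew, map_neg, LinearMap.neg_apply]
    have e' : h.lieScalarProduct.form ⁅Z, Y⁆ X = - h.lieScalarProduct.form ⁅Y, Z⁆ X := by
      rw [← lie_skew, map_neg, LinearMap.neg_apply]
    change P X Y Z = _
    linarith [M' X Y Z, M' Y Z X, M' Z X Y, T' X Y Z, T' Y Z X, T' X Z Y]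
  by_contra hne
  obtain ⟨Z, hZ⟩ := hinv.exists_mulInvariant_eq g
    (cov (mulInvariantVectorField Y) g (mulInvariantVectorField X g)
      - mulInvariantVectorField (h.lieScalarProduct.leviCivita X Y) g)
  have h1 := h.pos g _ (sub_ne_zero.2 hne)
  have h2 := key Z
  rw [hZ] at h2
  have h3 := congrArg (fun f => f (cov (mulInvariantVectorField Y) g (mulInvariantVectorField X g)
    - mulInvariantVectorField (h.lieScalarProduct.leviCivita X Y) g))
    ((h.inner g).map_sub (cov (mulInvariantVectorField Y) g (mulInvariantVectorField X g))
      (mulInvariantVectorField (h.lieScalarProduct.leviCivita X Y) g))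
  exact h1.ne' (h3.trans (sub_eq_zero.2 h2))

end Bundle.ContMDiffRiemannianMetric

end LieGroup

end

namespace ScalarProduct

/-! ### Orthonormal bases and traces for a scalar product. -/

section Orthonormal

variable {V : Type*} [AddCommGroup V] [Module ℝ V]

/-! For a cyclic scalar product Koszul's formula collapses to `⟨X ⋆ Y, Z⟩ = ⟨[Z, Y], X⟩`. In an
orthonormal basis `b`, set `S = ∑ |[b i, b j]|²` and `H = ∑ b i ⋆ b i`. The sectional terms then add
up to `-S + S/2 - |H|²`, the middle term coming from the cyclic identity for the structure
constants, so the scalar curvature is `-S/2 - |H|²` (`IsCyclicOn.scalarCurvature_eq`). It is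
negative as soon as some bracket is nonzero. Positive Ricci or sectional curvature would make it a
sum of nonnegative terms.

It remains to see that a connected non-abelian group has a nonzero bracket
(`LieGroup.mul_comm_of_bracket_eq_zero`). This is done without the exponential map. In a chart at
the identity, the bracket and the derivative of `Ad` are both the antisymmetrized mixed second
derivative of the multiplication. If brackets vanish, `Ad` has zero derivative at 1, hence
everywhere because it is a homomorphism, so `Ad = id` by connectedness. Then `x ↦ g x g⁻¹ x⁻¹` also
has zero derivative everywhere, and is constantly 1. -/

theorem exists_orthonormal_basis [FiniteDimensional ℝ V] (s : ScalarProduct V) :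
    ∃ b : Module.Basis (Fin (Module.finrank ℝ V)) ℝ V,
      ∀ i j, s.form (b i) (b j) = if i = j then 1 else 0 := by
  let core : InnerProductSpace.Core ℝ V :=
    { inner := fun u v => s.form u v
      conj_inner_symm := fun u v => s.symm v u
      re_inner_nonneg := fun u => by
        by_cases hu : u = 0
        · simp [hu]
        · exact (s.pos u hu).le
      add_left := fun u v w => by simp
      smul_left := fun u v c => by simp
      definite := fun u hu => by
        by_contra h
        exact (s.pos u h).ne' hu }
  let _ := core.toNormedAddCommGroup
  let _ : InnerProductSpace ℝ V := InnerProductSpace.ofCore core.toCore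
  let b := stdOrthonormalBasis ℝ V
  refine ⟨b.toBasis, fun i j => ?_⟩
  simp only [OrthonormalBasis.coe_toBasis]
  exact orthonormal_iff_ite.1 b.orthonormal i j

variable {ι : Type*} [Fintype ι] [DecidableEq ι]

theorem repr_eq_form {s : ScalarProduct V} {b : Module.Basis ι ℝ V}
    (hb : ∀ i j, s.form (b i) (b j) = if i = j then 1 else 0) (u : V) (i : ι) :
    b.repr u i = s.form u (b i) := by
  conv_rhs => rw [← b.sum_repr u]
  rw [map_sum, LinearMap.sum_apply]
  simp [hb, -Module.Basis.sum_repr]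

theorem form_eq_sum {s : ScalarProduct V} {b : Module.Basis ι ℝ V}
    (hb : ∀ i j, s.form (b i) (b j) = if i = j then 1 else 0) (u v : V) :
    s.form u v = ∑ i, s.form u (b i) * s.form v (b i) := by
  conv_lhs => rw [← b.sum_repr v]
  simp [repr_eq_form hb, mul_comm]

theorem trace_eq_sum_form {s : ScalarProduct V} {b : Module.Basis ι ℝ V}
    (hb : ∀ i j, s.form (b i) (b j) = if i = j then 1 else 0) (T : Module.End ℝ V) :
    LinearMap.trace ℝ V T = ∑ i, s.form (T (b i)) (b i) := by
  rw [LinearMap.trace_eq_matrix_trace ℝ b, Matrix.trace]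
  simp [LinearMap.toMatrix_apply, repr_eq_form hb]

theorem form_self_nonneg (s : ScalarProduct V) (u : V) : 0 ≤ s.form u u := by
  by_cases hu : u = 0
  · simp [hu]
  · exact (s.pos u hu).le

end Orthonormal

/-! ### Scalar curvature of a cyclic scalar product. -/

variable {L : Type*} [LieRing L] [LieAlgebra ℝ L] [FiniteDimensional ℝ L]
variable {ι : Type*} [Fintype ι] [DecidableEq ι]

/-- Metric compatibility: the right-hand side of Koszul's formula changes sign when `Y` and `Z` are
exchanged. -/
theorem form_leviCivita_right (s : ScalarProduct L) (X Y Z : L) :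
    s.form (s.leviCivita X Y) Z = -s.form Y (s.leviCivita X Z) := by
  rw [s.symm Y]
  have h1 := s.koszul_formula X Y Z
  have h2 := s.koszul_formula X Z Y
  rw [← lie_skew X Z, ← lie_skew Y X, ← lie_skew Y Z] at h2
  simp only [map_neg, LinearMap.neg_apply] at h2
  linarith

theorem ricci_eq_sum {s : ScalarProduct L} {b : Module.Basis ι ℝ L}
    (hb : ∀ i j, s.form (b i) (b j) = if i = j then 1 else 0) (X Y : L) :
    s.ricci X Y = ∑ j, s.form (s.curvature X (b j) Y) (b j) :=
  trace_eq_sum_form hb _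

theorem scalarCurvature_eq_sum_ricci {s : ScalarProduct L} {b : Module.Basis ι ℝ L}
    (hb : ∀ i j, s.form (b i) (b j) = if i = j then 1 else 0) :
    s.scalarCurvature = ∑ i, s.ricci (b i) (b i) := by
  rw [scalarCurvature, trace_eq_sum_form hb]
  simp

theorem form_curvature_self_left (s : ScalarProduct L) (X Y Z : L) :
    s.form (s.curvature X X Y) Z = 0 := by
  simp [curvature]

/-- A scalar product on a Lie algebra is cyclic if the cyclic sum of `⟨[X, Y], Z⟩` vanishes. -/
def IsCyclicOn (s : ScalarProduct L) : Prop :=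
  ∀ X Y Z : L, s.form ⁅X, Y⁆ Z + s.form ⁅Y, Z⁆ X + s.form ⁅Z, X⁆ Y = 0

/-- The cyclic identity turns the first two terms of Koszul's formula into a second copy of the
third. -/
theorem IsCyclicOn.form_leviCivita {s : ScalarProduct L} (hs : s.IsCyclicOn) (X Y Z : L) :
    s.form (s.leviCivita X Y) Z = s.form ⁅Z, Y⁆ X := by
  have h1 := s.koszul_formula X Y Z
  have h2 := hs X Y Z
  rw [← lie_skew Y Z, map_neg, LinearMap.neg_apply] at h2
  linarith

theorem IsCyclicOn.form_curvature {s : ScalarProduct L} (hs : s.IsCyclicOn) (X Y : L) :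
    s.form (s.curvature X Y X) Y = -s.form ⁅X, Y⁆ ⁅X, Y⁆
      + s.form (s.leviCivita Y X) (s.leviCivita X Y)
      - s.form (s.leviCivita X X) (s.leviCivita Y Y) := by
  simp only [curvature, LinearMap.sub_apply, Module.End.mul_apply, map_sub]
  rw [hs.form_leviCivita ⁅X, Y⁆, s.form_leviCivita_right X (s.leviCivita Y X),
    s.form_leviCivita_right Y (s.leviCivita X X),
    ← lie_skew Y X]
  simp only [map_neg, LinearMap.neg_apply]
  ring

/-- Multiply the cyclic identity for the structure constants `c i j k` by `c i j k` and sum over all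
indices. The two cross sums agree after rotating the indices, so each is minus half of `∑ (c i j
k)²`; up to sign, the left-hand side is such a cross sum. -/
theorem IsCyclicOn.sum_form_leviCivita_swap {s : ScalarProduct L} (hs : s.IsCyclicOn)
    {b : Module.Basis ι ℝ L} (hb : ∀ i j, s.form (b i) (b j) = if i = j then 1 else 0) :
    ∑ i, ∑ j, s.form (s.leviCivita (b j) (b i)) (s.leviCivita (b i) (b j))
      = (∑ i, ∑ j, s.form ⁅b i, b j⁆ ⁅b i, b j⁆) / 2 := by
  let c : ι → ι → ι → ℝ := fun i j k => s.form ⁅b i, b j⁆ (b k)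
  have skew : ∀ i j k, c i j k = -c j i k := fun i j k => by
    simp only [c]
    rw [← lie_skew, map_neg, LinearMap.neg_apply]
  have cyc : ∀ i j k, c i j k + c j k i + c k i j = 0 := fun i j k => hs _ _ _
  have h1 : ∀ i j, s.form (s.leviCivita (b j) (b i)) (s.leviCivita (b i) (b j))
      = ∑ k, c k i j * c k j i := fun i j => by
    rw [form_eq_sum hb]
    simp only [hs.form_leviCivita, c]
  have h2 : ∀ i j, s.form ⁅b i, b j⁆ ⁅b i, b j⁆ = ∑ k, c i j k * c i j k :=
    fun i j => form_eq_sum hb _ _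
  simp only [h1, h2]
  have rot : ∀ f : ι → ι → ι → ℝ, ∑ i, ∑ j, ∑ k, f i j k = ∑ i, ∑ j, ∑ k, f k i j := fun f => by
    rw [eq_comm, Finset.sum_congr rfl fun i _ => Finset.sum_comm]
    exact Finset.sum_comm
  have hA : ∑ i, ∑ j, ∑ k, c k i j * c k j i = -∑ i, ∑ j, ∑ k, c k i j * c j k i := by
    simp only [← Finset.sum_neg_distrib]
    refine Finset.sum_congr rfl fun i _ => Finset.sum_congr rfl fun j _ =>
      Finset.sum_congr rfl fun k _ => ?_
    rw [skew k j i]; ring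
  have hS : ∑ i, ∑ j, ∑ k, (c i j k * c i j k + c i j k * c j k i + c i j k * c k i j) = 0 :=
    Finset.sum_eq_zero fun i _ => Finset.sum_eq_zero fun j _ => Finset.sum_eq_zero fun k _ => by
      rw [← mul_add, ← mul_add, cyc, mul_zero]
  simp only [Finset.sum_add_distrib] at hS
  have r1 := rot fun i j k => c i j k * c j k i
  have r2 := rot fun i j k => c k i j * c i j k
  -- Puts the factors of every product in one order, so that equal sums become identical atoms for
  -- `linarith`.
  simp only [mul_comm (c _ _ _) (c _ _ _)] at r1 r2 hS hA ⊢
  linarith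

theorem IsCyclicOn.scalarCurvature_eq {s : ScalarProduct L} (hs : s.IsCyclicOn)
    {b : Module.Basis ι ℝ L} (hb : ∀ i j, s.form (b i) (b j) = if i = j then 1 else 0) :
    s.scalarCurvature = -(∑ i, ∑ j, s.form ⁅b i, b j⁆ ⁅b i, b j⁆) / 2
      - s.form (∑ i, s.leviCivita (b i) (b i)) (∑ i, s.leviCivita (b i) (b i)) := by
  rw [scalarCurvature_eq_sum_ricci hb]
  simp only [ricci_eq_sum hb, hs.form_curvature, Finset.sum_sub_distrib, Finset.sum_add_distrib,
    Finset.sum_neg_distrib, hs.sum_form_leviCivita_swap hb, map_sum, LinearMap.sum_apply]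
  rw [Finset.sum_comm (f := fun i j => s.form (s.leviCivita (b i) (b i))
    (s.leviCivita (b j) (b j)))]
  ring

theorem IsCyclicOn.scalarCurvature_neg {s : ScalarProduct L} (hs : s.IsCyclicOn)
    (hL : ∃ X Y : L, ⁅X, Y⁆ ≠ 0) : s.scalarCurvature < 0 := by
  obtain ⟨b, hb⟩ := s.exists_orthonormal_basis
  have hS : 0 < ∑ i, ∑ j, s.form ⁅b i, b j⁆ ⁅b i, b j⁆ := by
    by_contra! hle
    have hnn : ∀ i, 0 ≤ ∑ j, s.form ⁅b i, b j⁆ ⁅b i, b j⁆ := fun i =>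
      Finset.sum_nonneg fun j _ => s.form_self_nonneg _
    have h0 := (Finset.sum_eq_zero_iff_of_nonneg fun i _ => hnn i).1
      (le_antisymm hle (Finset.sum_nonneg fun i _ => hnn i))
    have hbr : ∀ i j, ⁅b i, b j⁆ = 0 := fun i j => by
      by_contra hne
      exact (s.pos _ hne).ne' ((Finset.sum_eq_zero_iff_of_nonneg fun j _ =>
        s.form_self_nonneg _).1 (h0 i (Finset.mem_univ i)) j (Finset.mem_univ j))
    obtain ⟨X, Y, hXY⟩ := hL
    refine hXY ?_
    rw [← b.sum_repr X, ← b.sum_repr Y, sum_lie]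
    refine Finset.sum_eq_zero fun i _ => ?_
    rw [lie_sum]
    refine Finset.sum_eq_zero fun j _ => ?_
    rw [smul_lie, lie_smul, hbr, smul_zero, smul_zero]
  rw [hs.scalarCurvature_eq hb]
  linarith [s.form_self_nonneg (∑ i, s.leviCivita (b i) (b i))]

/-! ### Positivity of Ricci or sectional curvature against scalar curvature. -/

/-- The inequality is not strict because the sum over a basis is empty in dimension 0. -/
theorem scalarCurvature_nonneg_of_ricci_pos (s : ScalarProduct L)
    (h : ∀ X : L, X ≠ 0 → 0 < s.ricci X X) : 0 ≤ s.scalarCurvature := by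
  obtain ⟨b, hb⟩ := s.exists_orthonormal_basis
  rw [scalarCurvature_eq_sum_ricci hb]
  exact Finset.sum_nonneg fun i _ => (h _ (b.ne_zero i)).le

/-- In an orthonormal basis the scalar curvature is the sum of `⟨K(b i, b j) b i, b j⟩`: diagonal
terms vanish, and the others are sectional curvatures with denominator 1. -/
theorem scalarCurvature_nonneg_of_sectionalCurvature_pos (s : ScalarProduct L)
    (h : ∀ X Y : L, LinearIndependent ℝ ![X, Y] → 0 < s.sectionalCurvature X Y) :
    0 ≤ s.scalarCurvature := by
  obtain ⟨b, hb⟩ := s.exists_orthonormal_basis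
  rw [scalarCurvature_eq_sum_ricci hb]
  simp only [ricci_eq_sum hb]
  refine Finset.sum_nonneg fun i _ => Finset.sum_nonneg fun j _ => ?_
  by_cases hij : i = j
  · rw [hij, form_curvature_self_left]
  · have hli : LinearIndependent ℝ ![b i, b j] := by
      have := b.linearIndependent.comp ![i, j] (by
        intro k l; fin_cases k <;> fin_cases l <;> simp [hij, Ne.symm hij])
      convert this using 1
      ext k; fin_cases k <;> rfl
    have := h _ _ hli
    simp only [sectionalCurvature, hb, hij] at this
    simpa using this.le

end ScalarProduct

noncomputable section

open Filter Topology

/-! ### Maps between manifolds with zero derivative. -/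

section LocallyConstant

variable {E : Type*} [NormedAddCommGroup E] [NormedSpace ℝ E]
  {M : Type*} [TopologicalSpace M] [ChartedSpace E M] [IsManifold 𝓘(ℝ, E) 1 M]
  {E' : Type*} [NormedAddCommGroup E'] [NormedSpace ℝ E']
  {M' : Type*} [TopologicalSpace M'] [ChartedSpace E' M'] [IsManifold 𝓘(ℝ, E') 1 M']

/-- Read in one fixed pair of charts, `f` has zero derivative on a ball, hence is constant there;
injectivity of the target chart brings this back to `f`. It is applied both to `Ad`, with values in
a vector space, and to commutators, with values in the group. -/
theorem isLocallyConstant_of_hasMFDerivAt_zero {f : M → M'}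
    (hf : ∀ x, HasMFDerivAt 𝓘(ℝ, E) 𝓘(ℝ, E') f x 0) : IsLocallyConstant f := by
  refine (IsLocallyConstant.iff_eventually_eq f).2 fun x => ?_
  set φ := extChartAt 𝓘(ℝ, E) x with hφ
  set φ' := extChartAt 𝓘(ℝ, E') (f x) with hφ'
  have hsymm : ContinuousAt φ.symm (φ x) := continuousAt_extChartAt_symm x
  have hx : φ.symm (φ x) = x := extChartAt_to_inv x
  have h1 : ∀ᶠ y in 𝓝 (φ x), y ∈ φ.target :=
    (isOpen_extChartAt_target x).mem_nhds (mem_extChartAt_target x)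
  have h2 : ∀ᶠ y in 𝓝 (φ x), f (φ.symm y) ∈ φ'.source := by
    have : ContinuousAt (f ∘ φ.symm) (φ x) :=
      ContinuousAt.comp (by rw [hx]; exact (hf x).continuousAt) hsymm
    refine this.preimage_mem_nhds ?_
    rw [Function.comp_apply, hx]
    exact extChartAt_source_mem_nhds (f x)
  obtain ⟨r, hr, hball⟩ := Metric.eventually_nhds_iff_ball.1 (h1.and h2)
  have hder : ∀ y ∈ Metric.ball (φ x) r, HasFDerivAt (φ' ∘ f ∘ φ.symm) (0 : E →L[ℝ] E') y := by
    intro y hy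
    obtain ⟨hy1, hy2⟩ := hball y hy
    have d1 : MDifferentiableAt 𝓘(ℝ, E) 𝓘(ℝ, E) φ.symm y :=
      ((contMDiffOn_extChartAt_symm (n := 1) x).contMDiffAt
        ((isOpen_extChartAt_target x).mem_nhds hy1)).mdifferentiableAt one_ne_zero
    have d2 : MDifferentiableAt 𝓘(ℝ, E') 𝓘(ℝ, E') φ' (f (φ.symm y)) :=
      (contMDiffAt_extChartAt' (n := 1) (by rwa [← extChartAt_source 𝓘(ℝ, E')])).mdifferentiableAt
        one_ne_zero
    have := d2.hasMFDerivAt.comp y ((hf (φ.symm y)).comp y d1.hasMFDerivAt)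
    refine hasMFDerivAt_iff_hasFDerivAt.1 (this.congr_mfderiv ?_)
    ext v
    exact map_zero (mfderiv 𝓘(ℝ, E') 𝓘(ℝ, E') φ' (f (φ.symm y)))
  have hconst : ∀ y ∈ Metric.ball (φ x) r, f (φ.symm y) = f x := by
    intro y hy
    have := Metric.isOpen_ball.is_const_of_fderiv_eq_zero (𝕜 := ℝ)
      (convex_ball (φ x) r).isPreconnected
      (fun y hy => (hder y hy).differentiableAt.differentiableWithinAt)
      (fun y hy => (hder y hy).fderiv) hy (Metric.mem_ball_self hr)
    simp only [Function.comp_apply, hx] at this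
    exact φ'.injOn (hball y hy).2 (mem_extChartAt_source (f x)) this
  filter_upwards [(continuousAt_extChartAt x).preimage_mem_nhds (Metric.ball_mem_nhds (φ x) hr),
    extChartAt_source_mem_nhds (I := 𝓘(ℝ, E)) x] with z hz hz'
  rw [← hconst _ hz, φ.left_inv hz']

end LocallyConstant

/-! ### Multiplication, conjugation and the adjoint representation in a chart at the identity. -/

namespace LieGroup

variable {E : Type*} [NormedAddCommGroup E] [NormedSpace ℝ E]
  (G : Type*) [TopologicalSpace G] [ChartedSpace E G] [Group G]

/-- The multiplication of a Lie group in the preferred chart at the identity. -/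
def mulCoord (p : E × E) : E :=
  extChartAt 𝓘(ℝ, E) (1 : G)
    ((extChartAt 𝓘(ℝ, E) (1 : G)).symm p.1 * (extChartAt 𝓘(ℝ, E) (1 : G)).symm p.2)

variable {G}

/-- Conjugation by `g` in the preferred chart at the identity. -/
def conjCoord (g : G) (b : E) : E :=
  extChartAt 𝓘(ℝ, E) (1 : G) (g * (extChartAt 𝓘(ℝ, E) (1 : G)).symm b * g⁻¹)

/-- The adjoint representation, in the preferred chart at the identity. -/
def adCoord (g : G) : E →L[ℝ] E :=
  fderiv ℝ (conjCoord g) (extChartAt 𝓘(ℝ, E) (1 : G) 1)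

local notation "φ" => extChartAt 𝓘(ℝ, E) (1 : G)
local notation "e₁" => (extChartAt 𝓘(ℝ, E) (1 : G)) (1 : G)

theorem symm_chart_one : (φ).symm e₁ = 1 := extChartAt_to_inv 1

theorem eventually_mem_target : ∀ᶠ a in 𝓝 e₁, a ∈ (φ).target :=
  (isOpen_extChartAt_target 1).mem_nhds (mem_extChartAt_target 1)

theorem mulCoord_left {b : E} (hb : b ∈ (φ).target) : mulCoord G (e₁, b) = b := by
  rw [mulCoord, symm_chart_one, one_mul, (φ).right_inv hb]

theorem mulCoord_right {a : E} (ha : a ∈ (φ).target) : mulCoord G (a, e₁) = a := by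
  rw [mulCoord, symm_chart_one, mul_one, (φ).right_inv ha]

theorem conjCoord_one (g : G) : conjCoord g e₁ = e₁ := by
  simp [conjCoord]

variable [LieGroup 𝓘(ℝ, E) ∞ G]

theorem contMDiffAt_chart_symm {a : E} (ha : a ∈ (φ).target) :
    ContMDiffAt 𝓘(ℝ, E) 𝓘(ℝ, E) ∞ (φ).symm a :=
  (contMDiffOn_extChartAt_symm 1).contMDiffAt ((isOpen_extChartAt_target 1).mem_nhds ha)

theorem contMDiffAt_chart {g : G} (hg : g ∈ (φ).source) :
    ContMDiffAt 𝓘(ℝ, E) 𝓘(ℝ, E) ∞ φ g :=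
  contMDiffAt_extChartAt' (by rwa [← extChartAt_source 𝓘(ℝ, E)])

theorem contDiffAt_chart_comp {F : Type*} [NormedAddCommGroup F] [NormedSpace ℝ F] {f : F → G}
    {x : F} (hf : ContMDiffAt 𝓘(ℝ, F) 𝓘(ℝ, E) ∞ f x) (hx : f x ∈ (φ).source) :
    ContDiffAt ℝ ∞ (fun y => φ (f y)) x :=
  contMDiffAt_iff_contDiffAt.1 ((contMDiffAt_chart hx).comp x hf)

theorem contMDiffAt_symm_comp {F : Type*} [NormedAddCommGroup F] [NormedSpace ℝ F] {f : F → E}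
    {x : F} (hf : ContDiffAt ℝ ∞ f x) (hx : f x ∈ (φ).target) :
    ContMDiffAt 𝓘(ℝ, F) 𝓘(ℝ, E) ∞ (fun y => (φ).symm (f y)) x :=
  (contMDiffAt_chart_symm hx).comp x hf.contMDiffAt

theorem contDiffAt_mulCoord {a b : E} (ha : a ∈ (φ).target) (hb : b ∈ (φ).target)
    (hab : (φ).symm a * (φ).symm b ∈ (φ).source) : ContDiffAt ℝ ∞ (mulCoord G) (a, b) :=
  contDiffAt_chart_comp (((contMDiffAt_symm_comp contDiffAt_fst ha)).mul
    (contMDiffAt_symm_comp contDiffAt_snd hb)) hab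

theorem contDiffAt_mulCoord_one : ContDiffAt ℝ ∞ (mulCoord G) (e₁, e₁) :=
  contDiffAt_mulCoord (mem_extChartAt_target 1) (mem_extChartAt_target 1)
    (by rw [symm_chart_one, mul_one]; exact mem_extChartAt_source 1)

theorem contDiffAt_mulCoord_right {a : E} (ha : a ∈ (φ).target) :
    ContDiffAt ℝ ∞ (mulCoord G) (a, e₁) :=
  contDiffAt_mulCoord ha (mem_extChartAt_target 1)
    (by rw [symm_chart_one, mul_one]; exact (φ).map_target ha)

theorem contDiffAt_mulCoord_left {b : E} (hb : b ∈ (φ).target) :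
    ContDiffAt ℝ ∞ (mulCoord G) (e₁, b) :=
  contDiffAt_mulCoord (mem_extChartAt_target 1) hb
    (by rw [symm_chart_one, one_mul]; exact (φ).map_target hb)

/-- The multiplication restricts to the identity map on each axis through `(e₁, e₁)`, which
determines both partial derivatives. -/
theorem fderiv_mulCoord_one (u v : E) : fderiv ℝ (mulCoord G) (e₁, e₁) (u, v) = u + v := by
  have hd : HasFDerivAt (mulCoord G) (fderiv ℝ (mulCoord G) (e₁, e₁)) (e₁, e₁) :=
    (contDiffAt_mulCoord_one.differentiableAt (by simp)).hasFDerivAt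
  have h1 : HasFDerivAt (fun a : E => mulCoord G (a, e₁)) (ContinuousLinearMap.id ℝ E) e₁ :=
    (hasFDerivAt_id e₁).congr_of_eventuallyEq (eventually_mem_target.mono fun a => mulCoord_right)
  have h2 : HasFDerivAt (fun b : E => mulCoord G (e₁, b)) (ContinuousLinearMap.id ℝ E) e₁ :=
    (hasFDerivAt_id e₁).congr_of_eventuallyEq (eventually_mem_target.mono fun a => mulCoord_left)
  have h1' := (hd.comp (f := fun a => (a, e₁)) e₁ (hasFDerivAt_prodMk_left e₁ e₁)).unique h1
  have h2' := (hd.comp (f := fun b => (e₁, b)) e₁ (hasFDerivAt_prodMk_right e₁ e₁)).unique h2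
  have e1 := DFunLike.congr_fun h1' u
  have e2 := DFunLike.congr_fun h2' v
  simp only [ContinuousLinearMap.comp_apply, ContinuousLinearMap.inl_apply,
    ContinuousLinearMap.inr_apply, ContinuousLinearMap.id_apply] at e1 e2
  calc _ = fderiv ℝ (mulCoord G) (e₁, e₁) ((u, 0) + (0, v)) := by simp
    _ = u + v := by rw [map_add, e1, e2]

theorem differentiableAt_fderiv_mulCoord :
    DifferentiableAt ℝ (fderiv ℝ (mulCoord G)) (e₁, e₁) :=
  (((contDiffAt_mulCoord_one (G := G)).of_le ENat.LEInfty.out).fderiv_right (n := 2) (m := 1)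
    one_add_one_eq_two.le).differentiableAt one_ne_zero

theorem contDiffAt_conjCoord_joint :
    ContDiffAt ℝ ∞ (fun p : E × E => conjCoord ((φ).symm p.1) p.2) (e₁, e₁) :=
  contDiffAt_chart_comp
    (((contMDiffAt_symm_comp contDiffAt_fst (mem_extChartAt_target 1)).mul
      (contMDiffAt_symm_comp contDiffAt_snd (mem_extChartAt_target 1))).mul
      (contMDiffAt_symm_comp contDiffAt_fst (mem_extChartAt_target 1)).inv)
    (by simp)

theorem contDiffAt_conjCoord (g : G) : ContDiffAt ℝ ∞ (conjCoord g) e₁ :=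
  contDiffAt_chart_comp
    ((contMDiffAt_const.mul (contMDiffAt_symm_comp contDiffAt_id (mem_extChartAt_target 1))).mul
      contMDiffAt_const) (by simp)

theorem hasFDerivAt_conjCoord (g : G) : HasFDerivAt (conjCoord g) (adCoord g) e₁ :=
  ((contDiffAt_conjCoord g).differentiableAt (by simp)).hasFDerivAt

theorem eventually_conj_mem (g : G) :
    ∀ᶠ b in 𝓝 e₁, g * (φ).symm b * g⁻¹ ∈ (φ).source := by
  have : ContMDiffAt 𝓘(ℝ, E) 𝓘(ℝ, E) ∞ (fun b : E => g * (φ).symm b * g⁻¹) e₁ :=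
    (contMDiffAt_const.mul (contMDiffAt_symm_comp contDiffAt_id (mem_extChartAt_target 1))).mul
      contMDiffAt_const
  refine this.continuousAt.preimage_mem_nhds ?_
  rw [symm_chart_one, mul_one, mul_inv_cancel]
  exact extChartAt_source_mem_nhds 1

/-- Chain rule: conjugation by `g * k` is the composite of the two conjugations near the fixed point
`e₁`. -/
theorem adCoord_mul (g k : G) : (adCoord (g * k) : E →L[ℝ] E) = (adCoord g).comp (adCoord k) := by
  have h : HasFDerivAt (conjCoord g ∘ conjCoord k) ((adCoord g).comp (adCoord k)) e₁ :=
    HasFDerivAt.comp _ (by rw [conjCoord_one]; exact hasFDerivAt_conjCoord g)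
      (hasFDerivAt_conjCoord k)
  refine (hasFDerivAt_conjCoord (g * k)).unique (h.congr_of_eventuallyEq ?_)
  filter_upwards [eventually_conj_mem k] with b hb
  simp only [conjCoord, Function.comp_apply, (φ).left_inv hb]
  group

theorem adCoord_one : adCoord (1 : G) = ContinuousLinearMap.id ℝ E := by
  refine (hasFDerivAt_conjCoord (1 : G)).unique ((hasFDerivAt_id e₁).congr_of_eventuallyEq ?_)
  filter_upwards [eventually_mem_target (G := G)] with b hb
  rw [conjCoord, one_mul, inv_one, mul_one, (φ).right_inv hb, id]

theorem differentiableAt_adCoord :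
    DifferentiableAt ℝ (fun a : E => (adCoord ((φ).symm a) : E →L[ℝ] E)) e₁ := by
  have h1 : ContDiffAt ℝ ∞ (Function.uncurry fun a b : E => conjCoord ((φ).symm a) b) (e₁, e₁) :=
    contDiffAt_conjCoord_joint
  exact ((h1.of_le ENat.LEInfty.out).fderiv (n := 2) (m := 1) contDiffAt_const
    one_add_one_eq_two.le).differentiableAt one_ne_zero

/-- The identity `(a b a⁻¹) a = a b`, differentiated in `b` at the identity. -/
theorem fderiv_mulCoord_adCoord :
    ∀ᶠ a in 𝓝 e₁, ∀ Y : E, fderiv ℝ (mulCoord G) (e₁, a) (adCoord ((φ).symm a) Y, 0)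
      = fderiv ℝ (mulCoord G) (a, e₁) (0, Y) := by
  filter_upwards [eventually_mem_target (G := G)] with a ha Y
  have hl : HasFDerivAt (fun b => mulCoord G (conjCoord ((φ).symm a) b, a)) _ e₁ :=
    HasFDerivAt.comp (g := mulCoord G) e₁
      (by rw [conjCoord_one]
          exact ((contDiffAt_mulCoord_left ha).differentiableAt (by simp)).hasFDerivAt)
      ((hasFDerivAt_conjCoord ((φ).symm a)).prodMk (hasFDerivAt_const a e₁))
  have hr : HasFDerivAt (fun b => mulCoord G (a, b)) _ e₁ :=
    HasFDerivAt.comp (g := mulCoord G) e₁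
      ((contDiffAt_mulCoord_right ha).differentiableAt (by simp)).hasFDerivAt
      ((hasFDerivAt_const a e₁).prodMk (hasFDerivAt_id e₁))
  have := hl.unique (hr.congr_of_eventuallyEq ?_)
  · exact DFunLike.congr_fun this Y
  · filter_upwards [eventually_conj_mem ((φ).symm a)] with b hb
    simp only [mulCoord, conjCoord, (φ).left_inv hb]
    group

theorem hasFDerivAt_fderiv_mulCoord_right (Y : E) :
    HasFDerivAt (fun a : E => fderiv ℝ (mulCoord G) (a, e₁) (0, Y))
      (((fderiv ℝ (fderiv ℝ (mulCoord G)) (e₁, e₁)).flip (0, Y)).comp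
        (ContinuousLinearMap.inl ℝ E E)) e₁ := by
  have h := (differentiableAt_fderiv_mulCoord (G := G)).hasFDerivAt.comp
    (f := fun a => (a, e₁)) e₁ (hasFDerivAt_prodMk_left e₁ e₁)
  exact (h.clm_apply (hasFDerivAt_const ((0 : E), Y) e₁)).congr_fderiv (by ext; simp)

/-- Differentiate `fderiv_mulCoord_adCoord` in `a` at `e₁` in the direction `X`. As `Ad 1 = id` and
the first derivative of the product is addition, the derivative of `Ad` is what remains besides two
mixed second derivatives; symmetry of the second derivative puts these in the stated form. -/
theorem fderiv_adCoord_apply (X Y : E) :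
    fderiv ℝ (fun a : E => (adCoord ((φ).symm a) : E →L[ℝ] E)) e₁ X Y
      = fderiv ℝ (fderiv ℝ (mulCoord G)) (e₁, e₁) (X, 0) (0, Y)
        - fderiv ℝ (fderiv ℝ (mulCoord G)) (e₁, e₁) (Y, 0) (0, X) := by
  have hA := (differentiableAt_adCoord (E := E) (G := G)).hasFDerivAt
  have h := (differentiableAt_fderiv_mulCoord (G := G)).hasFDerivAt.comp
    (f := fun a => (e₁, a)) e₁ (hasFDerivAt_prodMk_right e₁ e₁)
  have hl := h.clm_apply ((hA.clm_apply (hasFDerivAt_const Y e₁)).prodMk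
    (hasFDerivAt_const (0 : E) e₁))
  have hr := hasFDerivAt_fderiv_mulCoord_right (G := G) Y
  have := hl.unique (hr.congr_of_eventuallyEq
    ((fderiv_mulCoord_adCoord (G := G)).mono fun a ha => ha Y))
  have := DFunLike.congr_fun this X
  have hsymm : IsSymmSndFDerivAt ℝ (mulCoord G) (e₁, e₁) :=
    (contDiffAt_mulCoord_one (G := G)).isSymmSndFDerivAt (by
      rw [minSmoothness_of_isRCLikeNormedField]; exact ENat.LEInfty.out)
  simp only [ContinuousLinearMap.comp_zero, zero_add, _root_.add_apply,
    ContinuousLinearMap.comp_apply, ContinuousLinearMap.prod_apply, ContinuousLinearMap.flip_apply,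
    _root_.zero_apply, ContinuousLinearMap.inl_apply, ContinuousLinearMap.inr_apply,
    Function.comp_apply, symm_chart_one, adCoord_one, ContinuousLinearMap.id_apply,
    fderiv_mulCoord_one, add_zero, hsymm (0, X) (Y, 0)] at this
  exact eq_sub_of_add_eq this

/-! ### Left-invariant fields and their bracket in the chart. -/

theorem mfderiv_mul_left_eq {a : E} (ha : a ∈ (φ).target) (X : GroupLieAlgebra 𝓘(ℝ, E) G) :
    (mulInvariantVectorField X ((φ).symm a) : E)
      = mfderiv 𝓘(ℝ, E) 𝓘(ℝ, E) (φ).symm a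
        (fderiv ℝ (mulCoord G) (a, e₁) ((0 : E), mfderiv 𝓘(ℝ, E) 𝓘(ℝ, E) φ 1 X)) := by
  have hφ : HasMFDerivAt 𝓘(ℝ, E) 𝓘(ℝ, E) φ 1 (mfderiv 𝓘(ℝ, E) 𝓘(ℝ, E) φ 1) :=
    ((contMDiffAt_chart (mem_extChartAt_source 1)).mdifferentiableAt (by simp)).hasMFDerivAt
  have hm : HasFDerivAt (fun b => mulCoord G (a, b))
      ((fderiv ℝ (mulCoord G) (a, e₁)).comp (ContinuousLinearMap.inr ℝ E E)) e₁ :=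
    HasFDerivAt.comp (g := mulCoord G) (f := fun b => (a, b)) e₁
      ((contDiffAt_mulCoord_right ha).differentiableAt (by simp)).hasFDerivAt
      (hasFDerivAt_prodMk_right a e₁)
  have hs : HasMFDerivAt 𝓘(ℝ, E) 𝓘(ℝ, E) (φ).symm a (mfderiv 𝓘(ℝ, E) 𝓘(ℝ, E) (φ).symm a) :=
    ((contMDiffAt_chart_symm ha).mdifferentiableAt (by simp)).hasMFDerivAt
  have hs' : HasMFDerivAt 𝓘(ℝ, E) 𝓘(ℝ, E) (φ).symm (mulCoord G (a, e₁))
      (mfderiv 𝓘(ℝ, E) 𝓘(ℝ, E) (φ).symm a : E →L[ℝ] E) := by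
    rw [mulCoord_right ha]; exact hs
  have hcomp := HasMFDerivAt.comp (g := (φ).symm) (f := fun x => mulCoord G (a, φ x)) (1 : G) hs'
    (HasMFDerivAt.comp (g := fun b => mulCoord G (a, b)) (1 : G) hm.hasMFDerivAt hφ)
  have hev : (fun x => (φ).symm a * x) =ᶠ[𝓝 1] (φ).symm ∘ fun x => mulCoord G (a, φ x) := by
    have hc : ContinuousAt (fun x : G => (φ).symm a * x) 1 :=
      (contMDiff_mul_left (I := 𝓘(ℝ, E)) (n := ∞)).continuous.continuousAt
    have hmem : ∀ᶠ x in 𝓝 (1 : G), (φ).symm a * x ∈ (φ).source :=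
      hc.preimage_mem_nhds ((isOpen_extChartAt_source 1).mem_nhds
        (by rw [mul_one]; exact (φ).map_target ha))
    filter_upwards [hmem, extChartAt_source_mem_nhds (I := 𝓘(ℝ, E)) (1 : G)] with x hx hx'
    simp only [mulCoord, Function.comp_apply, (φ).left_inv hx', (φ).left_inv hx]
  exact DFunLike.congr_fun (hcomp.congr_of_eventuallyEq hev).mfderiv X

theorem mpullbackWithin_mulInvariantVectorField_eventuallyEq (X : GroupLieAlgebra 𝓘(ℝ, E) G) :
    (VectorField.mpullbackWithin 𝓘(ℝ, E) 𝓘(ℝ, E) (φ).symm (mulInvariantVectorField X)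
      (Set.range 𝓘(ℝ, E)) : E → E) =ᶠ[𝓝 e₁]
      fun a => fderiv ℝ (mulCoord G) (a, e₁) ((0 : E), mfderiv 𝓘(ℝ, E) 𝓘(ℝ, E) φ 1 X) := by
  filter_upwards [eventually_mem_target (G := G)] with a ha
  have hinv := isInvertible_mfderivWithin_extChartAt_symm (I := 𝓘(ℝ, E)) ha
  refine (hinv.inverse_apply_eq).2 ?_
  rw [ModelWithCorners.Boundaryless.range_eq_univ, mfderivWithin_univ]
  exact mfderiv_mul_left_eq ha X

/-- In the chart a left-invariant field is the derivative of the product in its second variable at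
`(a, e₁)`, so the bracket of two such fields at `e₁` is the difference of the two sides. -/
theorem fderiv_fderiv_mulCoord_symm_of_bracket_eq_zero
    (hbr : ∀ X Y : GroupLieAlgebra 𝓘(ℝ, E) G, ⁅X, Y⁆ = 0) (X Y : E) :
    fderiv ℝ (fderiv ℝ (mulCoord G)) (e₁, e₁) (X, 0) (0, Y)
      = fderiv ℝ (fderiv ℝ (mulCoord G)) (e₁, e₁) (Y, 0) (0, X) := by
  have hφ := isInvertible_mfderiv_extChartAt (I := 𝓘(ℝ, E))
    (mem_extChartAt_source (I := 𝓘(ℝ, E)) (1 : G))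
  obtain ⟨X', hX⟩ := hφ.bijective.surjective X
  obtain ⟨Y', hY⟩ := hφ.bijective.surjective Y
  let V (Z : GroupLieAlgebra 𝓘(ℝ, E) G) : E → E := VectorField.mpullbackWithin 𝓘(ℝ, E) 𝓘(ℝ, E)
    (φ).symm (mulInvariantVectorField Z) (Set.range 𝓘(ℝ, E))
  -- The bracket on the group is by definition the coordinate bracket carried back by the inverse of
  -- the chart's derivative, which is invertible.
  have h : VectorField.lieBracketWithin ℝ (V X') (V Y')
      ((φ).symm ⁻¹' Set.univ ∩ Set.range 𝓘(ℝ, E)) e₁ = 0 :=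
    (hφ.inverse_apply_eq.1 (hbr X' Y')).trans (map_zero (mfderiv 𝓘(ℝ, E) 𝓘(ℝ, E) φ 1))
  rw [Set.preimage_univ, Set.univ_inter, ModelWithCorners.Boundaryless.range_eq_univ,
    VectorField.lieBracketWithin_univ] at h
  have h1 : V X' =ᶠ[𝓝 e₁] _ := mpullbackWithin_mulInvariantVectorField_eventuallyEq X'
  have h2 : V Y' =ᶠ[𝓝 e₁] _ := mpullbackWithin_mulInvariantVectorField_eventuallyEq Y'
  have h3 := (h1.lieBracket_vectorField_eq (𝕜 := ℝ) h2).symm.trans h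
  rw [hX, hY] at h3
  rw [VectorField.lieBracket, (hasFDerivAt_fderiv_mulCoord_right X).fderiv,
    (hasFDerivAt_fderiv_mulCoord_right Y).fderiv] at h3
  simp only [fderiv_mulCoord_one, zero_add, ContinuousLinearMap.comp_apply,
    ContinuousLinearMap.flip_apply, ContinuousLinearMap.inl_apply] at h3
  exact sub_eq_zero.1 h3

/-! ### From vanishing brackets to a commutative group. -/

/-- At 1 this is `fderiv_adCoord_apply` with equal second derivatives; at `g` it follows from `Ad x
= Ad g ∘ Ad (g⁻¹ x)`. -/
theorem hasMFDerivAt_adCoord (hbr : ∀ X Y : GroupLieAlgebra 𝓘(ℝ, E) G, ⁅X, Y⁆ = 0) (g : G) :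
    HasMFDerivAt 𝓘(ℝ, E) 𝓘(ℝ, E →L[ℝ] E) (adCoord : G → E →L[ℝ] E) g 0 := by
  have h0 : HasFDerivAt (fun a : E => (adCoord ((φ).symm a) : E →L[ℝ] E))
      (0 : E →L[ℝ] (E →L[ℝ] E)) e₁ := by
    refine (differentiableAt_adCoord (E := E) (G := G)).hasFDerivAt.congr_fderiv ?_
    ext X Y
    rw [fderiv_adCoord_apply, fderiv_fderiv_mulCoord_symm_of_bracket_eq_zero hbr, sub_self]
    rfl
  have hφ : HasMFDerivAt 𝓘(ℝ, E) 𝓘(ℝ, E) φ 1 (mfderiv 𝓘(ℝ, E) 𝓘(ℝ, E) φ 1) :=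
    ((contMDiffAt_chart (mem_extChartAt_source 1)).mdifferentiableAt (by simp)).hasMFDerivAt
  have h1 : HasMFDerivAt 𝓘(ℝ, E) 𝓘(ℝ, E →L[ℝ] E) (adCoord : G → E →L[ℝ] E) 1 0 := by
    refine ((h0.hasMFDerivAt.comp (1 : G) hφ).congr_of_eventuallyEq ?_).congr_mfderiv ?_
    · filter_upwards [extChartAt_source_mem_nhds (I := 𝓘(ℝ, E)) (1 : G)] with x hx
      rw [Function.comp_apply, (φ).left_inv hx]
    · ext v; rfl
  -- The base point stays in the form `g⁻¹ * g`, the value at `g` of the translation composed with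
  -- below.
  have h1' : HasMFDerivAt 𝓘(ℝ, E) 𝓘(ℝ, E →L[ℝ] E) (adCoord : G → E →L[ℝ] E) (g⁻¹ * g)
      (0 : E →L[ℝ] (E →L[ℝ] E)) := by
    rw [inv_mul_cancel]; exact h1
  have hl : HasMFDerivAt 𝓘(ℝ, E) 𝓘(ℝ, E) (fun x => g⁻¹ * x) g _ :=
    ((contMDiff_mul_left (I := 𝓘(ℝ, E)) (n := ∞)).mdifferentiable (by simp) g).hasMFDerivAt
  have hL : HasFDerivAt (fun T : E →L[ℝ] E => (adCoord g : E →L[ℝ] E).comp T) _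
      (adCoord (g⁻¹ * g) : E →L[ℝ] E) :=
    (ContinuousLinearMap.compL ℝ E E E (adCoord g)).hasFDerivAt
  have := hL.hasMFDerivAt.comp g (HasMFDerivAt.comp (g := (adCoord : G → E →L[ℝ] E)) g h1' hl)
  refine (this.congr_of_eventuallyEq (Eventually.of_forall fun x => ?_)).congr_mfderiv ?_
  · simp only [Function.comp_apply]
    rw [← adCoord_mul, mul_inv_cancel_left]
  · ext v
    exact map_zero (ContinuousLinearMap.compL ℝ E E E (adCoord g))

theorem adCoord_eq_id [ConnectedSpace G] (hbr : ∀ X Y : GroupLieAlgebra 𝓘(ℝ, E) G, ⁅X, Y⁆ = 0)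
    (g : G) : adCoord g = ContinuousLinearMap.id ℝ E := by
  rw [← adCoord_one (G := G)]
  exact (isLocallyConstant_of_hasMFDerivAt_zero
    (hasMFDerivAt_adCoord hbr)).apply_eq_of_preconnectedSpace g 1

/-- With `q(a, b) = a b⁻¹` in coordinates, the commutator is `q(conj_g b, b)`. Since `Ad g = id`,
its derivative at `e₁` is that of `q(b, b)`, which is constant. -/
theorem hasMFDerivAt_conj_div_one {g : G} (hg : adCoord g = ContinuousLinearMap.id ℝ E) :
    HasMFDerivAt 𝓘(ℝ, E) 𝓘(ℝ, E) (fun x : G => g * x * g⁻¹ * x⁻¹) 1 0 := by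
  let q : E × E → E := fun p => φ ((φ).symm p.1 * ((φ).symm p.2)⁻¹)
  have hq : ContDiffAt ℝ ∞ q (e₁, e₁) :=
    contDiffAt_chart_comp ((contMDiffAt_symm_comp contDiffAt_fst (mem_extChartAt_target 1)).mul
      (contMDiffAt_symm_comp contDiffAt_snd (mem_extChartAt_target 1)).inv) (by simp)
  have hq' := (hq.differentiableAt (by simp)).hasFDerivAt
  have hdiag : HasFDerivAt (fun b => q (b, b)) _ e₁ :=
    HasFDerivAt.comp (g := q) (f := fun b => (b, b)) e₁ hq'
      ((hasFDerivAt_id e₁).prodMk (hasFDerivAt_id e₁))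
  have hconst : HasFDerivAt (fun b => q (b, b)) (0 : E →L[ℝ] E) e₁ := by
    have : (fun b => q (b, b)) = fun _ => e₁ := by
      funext b; simp only [q, mul_inv_cancel]
    rw [this]; exact hasFDerivAt_const _ _
  have hconj : HasFDerivAt (fun b => q (conjCoord g b, b)) _ e₁ :=
    HasFDerivAt.comp (g := q) (f := fun b => (conjCoord g b, b)) e₁
      (by rw [conjCoord_one]; exact hq') ((hasFDerivAt_conjCoord g).prodMk (hasFDerivAt_id e₁))
  rw [hg, hdiag.unique hconst] at hconj
  have hsm : ContMDiff 𝓘(ℝ, E) 𝓘(ℝ, E) ∞ (fun x : G => g * x * g⁻¹ * x⁻¹) :=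
    ((contMDiff_const.mul contMDiff_id).mul contMDiff_const).mul contMDiff_id.inv
  refine ⟨hsm.continuous.continuousAt, ?_⟩
  have h1 : g * 1 * g⁻¹ * 1⁻¹ = 1 := by simp
  simp only [writtenInExtChartAt, h1]
  refine (hconj.congr_of_eventuallyEq ?_).hasFDerivWithinAt
  filter_upwards [eventually_conj_mem g] with b hb
  simp only [q, conjCoord, Function.comp_apply, (φ).left_inv hb]

/-- Reduces to the identity by `g x g⁻¹ x⁻¹ = (g y g⁻¹) (g z g⁻¹ z⁻¹) y⁻¹` with `z = y⁻¹ x`. -/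
theorem hasMFDerivAt_conj_div {g : G} (hg : adCoord g = ContinuousLinearMap.id ℝ E) (y : G) :
    HasMFDerivAt 𝓘(ℝ, E) 𝓘(ℝ, E) (fun x : G => g * x * g⁻¹ * x⁻¹) y 0 := by
  have h1 : HasMFDerivAt 𝓘(ℝ, E) 𝓘(ℝ, E) (fun x : G => g * x * g⁻¹ * x⁻¹) (y⁻¹ * y)
      (0 : E →L[ℝ] E) := by
    rw [inv_mul_cancel]; exact hasMFDerivAt_conj_div_one hg
  have hl : HasMFDerivAt 𝓘(ℝ, E) 𝓘(ℝ, E) (fun x => y⁻¹ * x) y _ :=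
    ((contMDiff_mul_left (I := 𝓘(ℝ, E)) (n := ∞)).mdifferentiable (by simp) y).hasMFDerivAt
  have hsm : ContMDiff 𝓘(ℝ, E) 𝓘(ℝ, E) ∞ (fun z : G => g * y * g⁻¹ * z * y⁻¹) :=
    (contMDiff_const.mul contMDiff_id).mul contMDiff_const
  have hc := (HasMFDerivAt.comp (g := fun x : G => g * x * g⁻¹ * x⁻¹) y h1 hl)
  have := (hsm.mdifferentiable (by simp) _).hasMFDerivAt.comp y hc
  refine (this.congr_of_eventuallyEq (Eventually.of_forall fun x => ?_)).congr_mfderiv ?_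
  · simp only [Function.comp_apply]
    group
  · ext v
    exact map_zero (mfderiv 𝓘(ℝ, E) 𝓘(ℝ, E) (fun z : G => g * y * g⁻¹ * z * y⁻¹) _)

/-- A connected Lie group whose Lie algebra is abelian is abelian. -/
theorem mul_comm_of_bracket_eq_zero [ConnectedSpace G]
    (hbr : ∀ X Y : GroupLieAlgebra 𝓘(ℝ, E) G, ⁅X, Y⁆ = 0) (a b : G) : a * b = b * a := by
  have h := (isLocallyConstant_of_hasMFDerivAt_zero
    (hasMFDerivAt_conj_div (adCoord_eq_id hbr a))).apply_eq_of_preconnectedSpace b 1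
  simp only [mul_one, mul_inv_cancel, inv_one] at h
  rwa [mul_inv_eq_one, mul_inv_eq_iff_eq_mul] at h

end LieGroup

end

theorem mainTheorem6 {n : ℕ} {G : Type*} [TopologicalSpace G]
    [ChartedSpace (EuclideanSpace ℝ (Fin n)) G] [Group G] [LieGroup (𝓡 n) ∞ G]
    [ConnectedSpace G]
    (h : ContMDiffRiemannianMetric (𝓡 n) ∞ (EuclideanSpace ℝ (Fin n))
      (fun x : G => TangentSpace (𝓡 n) x))
    (hcyc : h.IsCyclic) (hG : ¬ ∀ a b : G, a * b = b * a) :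
    h.lieScalarProduct.scalarCurvature < 0 ∧
    (¬ ∀ X Y : GroupLieAlgebra (𝓡 n) G, LinearIndependent ℝ ![X, Y] →
      0 < h.lieScalarProduct.sectionalCurvature X Y) ∧
    (¬ ∀ X : GroupLieAlgebra (𝓡 n) G, X ≠ 0 → 0 < h.lieScalarProduct.ricci X X) := by
  have hbr : ∃ X Y : GroupLieAlgebra (𝓡 n) G, ⁅X, Y⁆ ≠ 0 := by
    by_contra! hbr
    exact hG (LieGroup.mul_comm_of_bracket_eq_zero hbr)
  have hs : h.lieScalarProduct.IsCyclicOn := hcyc.2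
  have hneg := hs.scalarCurvature_neg hbr
  exact ⟨hneg,
    fun hsec => hneg.not_ge
      (h.lieScalarProduct.scalarCurvature_nonneg_of_sectionalCurvature_pos hsec),
    fun hric => hneg.not_ge
      (h.lieScalarProduct.scalarCurvature_nonneg_of_ricci_pos hric)⟩
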